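/- Let $n\ge 1$. A convex body in $\mathbf R^n$ is a compact convex set $C\subset\mathbf R^n$ with nonempty interior; an ellipsoid is the image of the closed Euclidean unit ball $B_2^n$ under an invertible affine map of $\mathbf R^n$; and $|\cdot|$ denotes volume. The volume ratio of a convex body $C$ is $$\mathrm{vr}(C)=\left(\frac{|C|}{|\mathcal E|}\right)^{1/n},$$ where $\mathcal E$ is an ellipsoid of maximal volume included in $C$. Then simplices have maximal volume ratio among all convex bodies in $\mathbf R^n$: for every convex body $C$ in $\mathbf R^n$ and every $n$-dimensional (solid) simplex $T$ in $\mathbf R^n$, $$\mathrm{vr}(C)\le \mathrm{vr}(T).$$ Equivalently, if $C$ is a convex body in $\mathbf R^n$ and $B_2^n$ is an ellipsoid of maximal volume included in $C$, then $$|C|\le \frac{n^{n/2}(n+1)^{(n+1)/2}}{n!}.$$ -/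

import Mathlib

open MeasureTheory

/-- A (solid, nondegenerate) ellipsoid in `ℝⁿ`: the image of the closed Euclidean unit ball
under an invertible affine map. -/
def IsEllipsoid {n : ℕ} (E : Set (EuclideanSpace ℝ (Fin n))) : Prop :=
  ∃ f : EuclideanSpace ℝ (Fin n) ≃ᵃ[ℝ] EuclideanSpace ℝ (Fin n),
    E = f '' Metric.closedBall 0 1

/-- `E` is an ellipsoid of maximal volume among the ellipsoids included in `C`. -/
structure IsMaximalEllipsoid {n : ℕ} (C E : Set (EuclideanSpace ℝ (Fin n))) : Prop where
  isEllipsoid : IsEllipsoid E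
  subset : E ⊆ C
  volume_le : ∀ E' : Set (EuclideanSpace ℝ (Fin n)),
    IsEllipsoid E' → E' ⊆ C → volume E' ≤ volume E

theorem volume_affine_image_ball {n : ℕ}
    (A : EuclideanSpace ℝ (Fin n) →L[ℝ] EuclideanSpace ℝ (Fin n))
    (c : EuclideanSpace ℝ (Fin n)) :
    volume ((fun x => A x + c) '' Metric.closedBall 0 1) =
      ENNReal.ofReal |A.det| * volume (Metric.closedBall (0 : EuclideanSpace ℝ (Fin n)) 1) := by
  have h : (fun x => A x + c) '' Metric.closedBall 0 1 =
      (fun x => x + c) '' (A '' Metric.closedBall 0 1) := by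
    rw [Set.image_image]
  rw [h, Set.image_add_right, measure_preimage_add_right, Measure.addHaar_image_continuousLinearMap]

/-- Every convex body with nonempty interior includes an ellipsoid of maximal volume. -/
theorem ConvexBody.exists_isMaximalEllipsoid {n : ℕ}
    (C : ConvexBody (EuclideanSpace ℝ (Fin n)))
    (hC : (interior (C : Set (EuclideanSpace ℝ (Fin n)))).Nonempty) :
    ∃ E : Set (EuclideanSpace ℝ (Fin n)),
      IsMaximalEllipsoid (C : Set (EuclideanSpace ℝ (Fin n))) E := by
  let V := EuclideanSpace ℝ (Fin n)
  let K : Set ((V →L[ℝ] V) × V) := {p | ∀ x ∈ Metric.closedBall (0 : V) 1, p.1 x + p.2 ∈ (C : Set V)}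
  have : ProperSpace ((V →L[ℝ] V) × V) := FiniteDimensional.proper ℝ _
  have hKclosed : IsClosed K := by
    have : K = ⋂ x ∈ Metric.closedBall (0 : V) 1,
        (fun p : (V →L[ℝ] V) × V => p.1 x + p.2) ⁻¹' (C : Set V) := by
      ext p; simp [K]
    rw [this]
    refine isClosed_biInter fun x _ => C.isClosed.preimage ?_
    fun_prop
  obtain ⟨R, hR⟩ := C.isCompact.isBounded.exists_norm_le
  have hKbdd : Bornology.IsBounded K := by
    refine isBounded_iff_forall_norm_le.2 ⟨2 * R, fun p hp => ?_⟩
    have h0 : ‖p.2‖ ≤ R := hR _ (by simpa using hp 0 (by simp))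
    have hR0 : 0 ≤ R := (norm_nonneg _).trans h0
    refine max_le ?_ (by linarith)
    refine ContinuousLinearMap.opNorm_le_of_unit_norm (by linarith) fun x hx => ?_
    have h1 : ‖p.1 x + p.2‖ ≤ R := hR _ (hp x (by simp [hx]))
    calc ‖p.1 x‖ = ‖(p.1 x + p.2) - p.2‖ := by simp
      _ ≤ 2 * R := (norm_sub_le _ _).trans (by linarith)
  have hK : IsCompact K := Metric.isCompact_of_isClosed_isBounded hKclosed hKbdd
  obtain ⟨a, ha⟩ := hC
  obtain ⟨r, hr, hball⟩ := Metric.isOpen_iff.1 isOpen_interior a ha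
  have hmem : ((r / 2) • ContinuousLinearMap.id ℝ V, a) ∈ K := by
    intro x hx
    refine interior_subset (hball ?_)
    have hx1 : ‖x‖ ≤ 1 := by simpa using hx
    have : ‖(r / 2) • x‖ < r := by
      rw [norm_smul, Real.norm_of_nonneg (by positivity)]
      nlinarith [norm_nonneg x]
    simpa [Metric.mem_ball, dist_eq_norm] using this
  obtain ⟨p, hp, hmax⟩ := hK.exists_isMaxOn ⟨_, hmem⟩
    (f := fun p : (V →L[ℝ] V) × V => |p.1.det|)
    ((ContinuousLinearMap.continuous_det.comp continuous_fst).abs.continuousOn)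
  have hdet : p.1.det ≠ 0 := by
    have h := hmax hmem
    have hpos : 0 < |((r / 2) • ContinuousLinearMap.id ℝ V).det| := by
      have : ((r / 2) • ContinuousLinearMap.id ℝ V).det = (r / 2) ^ Module.finrank ℝ V := by
        change LinearMap.det ((r / 2) • (LinearMap.id : V →ₗ[ℝ] V)) = _
        simp
      rw [this]
      positivity
    exact abs_pos.1 (lt_of_lt_of_le hpos h)
  let e : V ≃ₗ[ℝ] V := LinearEquiv.ofIsUnitDet (f := (p.1 : V →ₗ[ℝ] V))
    (v := Module.finBasis ℝ V) (v' := Module.finBasis ℝ V)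
    (by rw [LinearMap.det_toMatrix]; exact isUnit_iff_ne_zero.2 hdet)
  refine ⟨(fun x => p.1 x + p.2) '' Metric.closedBall 0 1, ?_, ?_, ?_⟩
  · refine ⟨e.toAffineEquiv.trans (AffineEquiv.constVAdd ℝ V p.2), ?_⟩
    refine Set.image_congr fun x _ => ?_
    simp [e, add_comm]
  · rintro _ ⟨x, hx, rfl⟩
    exact hp x hx
  · rintro _ ⟨f, rfl⟩ hf
    have hform : ∀ x, f x = LinearMap.toContinuousLinearMap (f.linear : V →ₗ[ℝ] V) x + f 0 := by
      intro x
      have := f.map_vadd 0 x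
      simpa using this
    have himg : f '' Metric.closedBall 0 1 =
        (fun x => LinearMap.toContinuousLinearMap (f.linear : V →ₗ[ℝ] V) x + f 0) ''
          Metric.closedBall 0 1 := Set.image_congr fun x _ => hform x
    have hq : (LinearMap.toContinuousLinearMap (f.linear : V →ₗ[ℝ] V), f 0) ∈ K := by
      intro x hx
      have := hf ⟨x, hx, rfl⟩
      rwa [hform x] at this
    rw [himg, volume_affine_image_ball, volume_affine_image_ball]
    gcongr ENNReal.ofReal ?_ * _
    exact hmax hq

/-- An ellipsoid of maximal volume included in the convex body `C`. -/
noncomputable def ConvexBody.maximalEllipsoid {n : ℕ}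
    (C : ConvexBody (EuclideanSpace ℝ (Fin n)))
    (hC : (interior (C : Set (EuclideanSpace ℝ (Fin n)))).Nonempty) :
    Set (EuclideanSpace ℝ (Fin n)) :=
  Classical.choose (C.exists_isMaximalEllipsoid hC)

/-- The volume ratio `(|C| / |E|) ^ (1 / n)` of an `n`-dimensional convex body `C` in `ℝⁿ`,
where `E` is the ellipsoid of maximal volume included in `C`. -/
noncomputable def ConvexBody.volumeRatio {n : ℕ}
    (C : ConvexBody (EuclideanSpace ℝ (Fin n)))
    (hC : (interior (C : Set (EuclideanSpace ℝ (Fin n)))).Nonempty) : ℝ :=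
  (volume.real (C : Set (EuclideanSpace ℝ (Fin n))) / volume.real (C.maximalEllipsoid hC)) ^
    (1 / (n : ℝ))

/-- The volume ratio may be computed with any ellipsoid of maximal volume included in `C`. -/
theorem ConvexBody.volumeRatio_eq {n : ℕ}
    (C : ConvexBody (EuclideanSpace ℝ (Fin n)))
    (hC : (interior (C : Set (EuclideanSpace ℝ (Fin n)))).Nonempty)
    {E : Set (EuclideanSpace ℝ (Fin n))} (hE : IsMaximalEllipsoid C E) :
    C.volumeRatio hC =
      (volume.real (C : Set (EuclideanSpace ℝ (Fin n))) / volume.real E) ^ (1 / (n : ℝ)) := by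
  have h := Classical.choose_spec (C.exists_isMaximalEllipsoid hC)
  have : volume (C.maximalEllipsoid hC) = volume E :=
    le_antisymm (hE.volume_le _ h.isEllipsoid h.subset)
      (h.volume_le _ hE.isEllipsoid hE.subset)
  simp only [ConvexBody.volumeRatio, Measure.real, this]

/-- The solid `n`-dimensional simplex (tetrahedron) in `ℝⁿ` with the given `n + 1` affinely
independent vertices, as a convex body. -/
noncomputable def solidSimplex {n : ℕ} (T : Affine.Simplex ℝ (EuclideanSpace ℝ (Fin n)) n) :
    ConvexBody (EuclideanSpace ℝ (Fin n)) where
  carrier := convexHull ℝ (Set.range T.points)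
  convex' := convex_convexHull ℝ _
  isCompact' := (Set.finite_range _).isCompact_convexHull ℝ
  nonempty' := (Set.range_nonempty _).convexHull

theorem solidSimplex_interior_nonempty {n : ℕ}
    (T : Affine.Simplex ℝ (EuclideanSpace ℝ (Fin n)) n) :
    (interior (solidSimplex T : Set (EuclideanSpace ℝ (Fin n)))).Nonempty := by
  change (interior (convexHull ℝ (Set.range T.points))).Nonempty
  rw [interior_convexHull_nonempty_iff_affineSpan_eq_top]
  exact T.independent.affineSpan_eq_top_iff_card_eq_finrank_add_one.2 (by simp)

/-! Both halves compare |C|/|E| with one number, the volume `regularSimplexVolume n` of the regular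
simplex circumscribed to the unit ball, divided by the volume of the ball. The quotient is affine
invariant, so E may be taken to be the unit ball.

Upper bound (Ball's argument). John's theorem (`IsMaximalEllipsoid.exists_john_decomposition`) gives
contact points u_i and weights c_i with ∑ c_i u_i ⊗ u_i = I and ∑ c_i u_i = 0. The centering
condition allows the u_i to be lifted to unit vectors of ℝⁿ⁺¹, proportional to (-√n u_i, 1), which
again decompose the identity after rescaling the weights. The geometric Brascamp-Lieb inequality for
exponential densities (`lintegral_exp_neg_sum_inner_le_one`) then bounds by 1 the integral of an
exponential of the height over a domain containing the cone over the interior of C, and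
`lintegral_cone_exp_neg` evaluates the integral over that cone as a constant times |C|.

Lower bound. For a simplex containing the ball, the cone over it is essentially the set where n + 1
independent linear functionals are positive. The integral of the exponential there is a reciprocal
determinant; Hadamard's inequality and AM-GM on the barycentric coordinates of the center bound it
below by the same number. -/

/-! ### Geometric Brascamp-Lieb inequality for exponential densities, by transport. -/

section BrascampLieb

variable {F ι : Type*} [NormedAddCommGroup F] [InnerProductSpace ℝ F] [Fintype ι]

/-- The geometric form of the determinant inequality behind the Brascamp-Lieb inequality. -/
theorem prod_rpow_le_det_sum_smulRight [FiniteDimensional ℝ F] (v : ι → F) (c t : ι → ℝ)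
    (hc : ∀ i, 0 ≤ c i) (ht : ∀ i, 0 < t i) (hv : ∀ i, ‖v i‖ = 1)
    (hI : ∀ x : F, ∑ i, c i * inner ℝ (v i) x ^ 2 = ‖x‖ ^ 2) :
    ∏ i, t i ^ c i ≤ (∑ i, (c i * t i) • (innerSL ℝ (v i)).smulRight (v i) : F →L[ℝ] F).det := by
  set A : F →L[ℝ] F := ∑ i, (c i * t i) • (innerSL ℝ (v i)).smulRight (v i) with hA
  have hAx : ∀ x y, inner ℝ (A x) y =
      ∑ i, c i * t i * (inner ℝ (v i) x * inner ℝ (v i) y) := by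
    intro x y
    simp [hA, sum_inner, inner_smul_left, mul_assoc]
  have hsymm : (A : F →ₗ[ℝ] F).IsSymmetric := by
    intro x y
    change inner ℝ (A x) y = inner ℝ x (A y)
    rw [hAx, real_inner_comm, hAx]
    simp only [mul_comm (inner ℝ (v _) x)]
  let e := hsymm.eigenvectorBasis rfl
  have heig : ∀ k, hsymm.eigenvalues rfl k =
      ∑ i, (c i * inner ℝ (v i) (e k) ^ 2) * t i := by
    intro k
    have h1 : A (e k) = hsymm.eigenvalues rfl k • e k :=
      hsymm.apply_eigenvectorBasis rfl k
    have h2 := hAx (e k) (e k)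
    rw [h1, inner_smul_left, real_inner_self_eq_norm_sq, e.norm_eq_one] at h2
    simp only [conj_trivial, one_pow, mul_one] at h2
    rw [h2]
    exact Finset.sum_congr rfl fun i _ => by ring
  have hdet : A.det = ∏ k, hsymm.eigenvalues rfl k := hsymm.det_eq_prod_eigenvalues rfl
  rw [hdet]
  -- Since `v i` is a unit vector, its squared coordinates in the eigenbasis sum to 1 and split the
  -- exponent. For fixed `k`, `hI` at `e k` makes the exponents sum to 1, so AM-GM applies to each
  -- eigenvalue.
  calc ∏ i, t i ^ c i = ∏ i, ∏ k, t i ^ (c i * inner ℝ (v i) (e k) ^ 2) := by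
        refine Finset.prod_congr rfl fun i _ => ?_
        rw [← Real.rpow_sum_of_pos (ht i), ← Finset.mul_sum, e.sum_sq_inner_left, hv]
        simp
    _ = ∏ k, ∏ i, t i ^ (c i * inner ℝ (v i) (e k) ^ 2) := Finset.prod_comm
    _ ≤ ∏ k, hsymm.eigenvalues rfl k := by
        refine Finset.prod_le_prod
          (fun k _ => Finset.prod_nonneg fun i _ => Real.rpow_nonneg (ht i).le _) fun k _ => ?_
        rw [heig]
        refine Real.geom_mean_le_arith_mean_weighted _ _ _
          (fun i _ => mul_nonneg (hc i) (sq_nonneg _)) ?_ fun i _ => (ht i).le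
        rw [hI, e.norm_eq_one, one_pow]

/-- The monotone transport of the exponential distribution to the Gaussian density
`exp (-π x ^ 2)`. -/
theorem exists_transport_exp_to_gaussian :
    ∃ T T' : ℝ → ℝ, ∀ t, 0 < t → HasDerivAt T (T' t) t ∧ 0 < T' t ∧
      Real.exp (-t) = Real.exp (-Real.pi * T t ^ 2) * T' t := by
  let g : ℝ → ℝ := fun u => Real.exp (-Real.pi * u ^ 2)
  have hg : Continuous g := by fun_prop
  have hgi : Integrable g := integrable_exp_neg_mul_sq Real.pi_pos
  -- Gaussian distribution function; the transport solves G(T t) = 1 - exp(-t), and differentiating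
  -- this gives the density identity.
  let G : ℝ → ℝ := fun s => 1 / 2 + ∫ u in (0 : ℝ)..s, g u
  have hGd : ∀ s, HasStrictDerivAt G (g s) s := fun s =>
    (intervalIntegral.integral_hasStrictDerivAt_right (hg.intervalIntegrable _ _)
      (hg.stronglyMeasurableAtFilter _ _) hg.continuousAt).const_add _
  have hGm : StrictMono G := strictMono_of_hasDerivAt_pos
    (fun s => (hGd s).hasDerivAt) fun s => Real.exp_pos _
  have hGc : Continuous G := continuous_iff_continuousAt.2 fun s => (hGd s).hasDerivAt.continuousAt
  have htop : Filter.Tendsto G Filter.atTop (nhds 1) := by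
    have h := intervalIntegral_tendsto_integral_Ioi 0 hgi.integrableOn Filter.tendsto_id
    rw [integral_gaussian_Ioi, div_self Real.pi_ne_zero, Real.sqrt_one] at h
    have h2 := h.const_add (1 / 2 : ℝ)
    norm_num at h2
    exact h2
  have hneg : ∀ s, G (-s) = 1 - G s := by
    intro s
    have h : ∫ u in (0 : ℝ)..(-s), g u = -∫ u in (0 : ℝ)..s, g u := by
      have h1 := intervalIntegral.integral_comp_neg (a := 0) (b := s) g
      rw [neg_zero] at h1
      rw [intervalIntegral.integral_symm, ← h1]
      simp [g]
    simp only [G, h]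
    ring
  have hsurj : ∀ t, 0 < t → ∃ s, G s = 1 - Real.exp (-t) := by
    intro t ht
    have hpos := Real.exp_pos (-t)
    have hlt : Real.exp (-t) < 1 := Real.exp_lt_one_iff.2 (by linarith)
    obtain ⟨a, ha⟩ := (htop.eventually (lt_mem_nhds (show 1 - Real.exp (-t) < 1 by linarith))).exists
    obtain ⟨b, hb⟩ := (htop.eventually (lt_mem_nhds hlt)).exists
    exact mem_range_of_exists_le_of_exists_ge hGc ⟨-b, by rw [hneg]; linarith⟩ ⟨a, ha.le⟩
  let Q := Function.invFun G
  have hQ : ∀ s, Q (G s) = s := Function.leftInverse_invFun hGm.injective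
  refine ⟨fun t => Q (1 - Real.exp (-t)),
    fun t => (g (Q (1 - Real.exp (-t))))⁻¹ * Real.exp (-t), fun t ht => ?_⟩
  obtain ⟨s, hs⟩ := hsurj t ht
  have hQs : Q (1 - Real.exp (-t)) = s := by rw [← hs, hQ]
  have hgs : 0 < g s := Real.exp_pos _
  refine ⟨?_, ?_, ?_⟩
  · have h1 : HasDerivAt Q (g s)⁻¹ (1 - Real.exp (-t)) := by
      rw [← hs]
      exact ((hGd s).to_local_left_inverse hgs.ne' (Filter.Eventually.of_forall hQ)).hasDerivAt
    have h2 : HasDerivAt (fun t : ℝ => 1 - Real.exp (-t)) (Real.exp (-t)) t := by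
      simpa using ((hasDerivAt_neg t).exp).const_sub 1
    simp only [hQs]
    exact h1.comp t h2
  · simp only [hQs]
    positivity
  · simp only [hQs]
    change _ = g s * _
    field_simp

/-- Pair the sum S with itself and use 2ab ≤ a² + b²: this gives ‖S‖² ≤ (∑ c_i a_i² + ‖S‖²)/2,
because `hI` turns ∑ c_i ⟪v_i, S⟫² back into ‖S‖². -/
theorem norm_sum_smul_sq_le (v : ι → F) (c a : ι → ℝ) (hc : ∀ i, 0 ≤ c i)
    (hI : ∀ x : F, ∑ i, c i * inner ℝ (v i) x ^ 2 = ‖x‖ ^ 2) :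
    ‖∑ i, (c i * a i) • v i‖ ^ 2 ≤ ∑ i, c i * a i ^ 2 := by
  set S := ∑ i, (c i * a i) • v i with hS
  have h1 : ‖S‖ ^ 2 = ∑ i, c i * a i * inner ℝ (v i) S := by
    rw [← real_inner_self_eq_norm_sq]
    conv_lhs => enter [2]; rw [hS]
    simp [sum_inner, inner_smul_left]
  have h2 : ∑ i, c i * a i * inner ℝ (v i) S ≤
      ∑ i, (c i * a i ^ 2 + c i * inner ℝ (v i) S ^ 2) / 2 :=
    Finset.sum_le_sum fun i _ => by nlinarith [mul_nonneg (hc i) (sq_nonneg (a i - inner ℝ (v i) S))]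
  rw [← Finset.sum_div, Finset.sum_add_distrib, hI] at h2
  linarith

/-- The geometric Brascamp-Lieb inequality for exponential densities. -/
theorem lintegral_exp_neg_sum_inner_le_one [FiniteDimensional ℝ F] [MeasurableSpace F]
    [BorelSpace F] (v : ι → F) (c : ι → ℝ) (hc : ∀ i, 0 ≤ c i) (hv : ∀ i, ‖v i‖ = 1)
    (hI : ∀ x : F, ∑ i, c i * inner ℝ (v i) x ^ 2 = ‖x‖ ^ 2) :
    ∫⁻ x in {x : F | ∀ i, 0 < inner ℝ (v i) x},
      ENNReal.ofReal (Real.exp (-∑ i, c i * inner ℝ (v i) x)) ≤ 1 := by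
  obtain ⟨T, T', hT⟩ := exists_transport_exp_to_gaussian
  set s : Set F := {x : F | ∀ i, 0 < inner ℝ (v i) x} with hs
  have hsm : MeasurableSet s := by
    rw [hs, Set.ofPred_forall]
    exact MeasurableSet.iInter fun i => (isOpen_lt (by fun_prop) (by fun_prop)).measurableSet
  have hTm : StrictMonoOn T (Set.Ioi 0) := by
    refine strictMonoOn_of_hasDerivWithinAt_pos (f' := T') (convex_Ioi 0)
      (fun t ht => (hT t ht).1.continuousAt.continuousWithinAt)
      (fun t ht => ?_) fun t ht => ?_
    · rw [interior_Ioi] at ht ⊢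
      exact (hT t ht).1.hasDerivWithinAt
    · rw [interior_Ioi] at ht
      exact (hT t ht).2.1
  let S : F → F := fun x => ∑ i, (c i * T (inner ℝ (v i) x)) • v i
  let S' : F → F →L[ℝ] F := fun x =>
    ∑ i, (c i * T' (inner ℝ (v i) x)) • (innerSL ℝ (v i)).smulRight (v i)
  have hS : ∀ x ∈ s, HasFDerivWithinAt S (S' x) s x := by
    intro x hx
    refine (HasFDerivAt.fun_sum fun i _ => ?_).hasFDerivWithinAt
    have h1 : HasFDerivAt (fun x : F => inner ℝ (v i) x) (innerSL ℝ (v i)) x :=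
      (innerSL ℝ (v i)).hasFDerivAt
    have h2 := (((hT _ (hx i)).1.comp_hasFDerivAt x h1).const_mul (c i)).smul_const (v i)
    convert! h2 using 1
    ext y
    simp [mul_assoc, smul_smul]
  -- S is a monotone map: every term of ⟪S x - S y, x - y⟫ is nonnegative. If the sum vanishes, each
  -- `i` with c_i ≠ 0 has ⟪v_i, x⟫ = ⟪v_i, y⟫, and `hI` forces x = y.
  have hinj : Set.InjOn S s := by
    intro x hx y hy hxy
    have h0 : inner ℝ (S x - S y) (x - y) = 0 := by rw [hxy, sub_self, inner_zero_left]
    have h1 : inner ℝ (S x - S y) (x - y) = ∑ i, c i *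
        ((T (inner ℝ (v i) x) - T (inner ℝ (v i) y)) * (inner ℝ (v i) x - inner ℝ (v i) y)) := by
      simp only [S, ← Finset.sum_sub_distrib, ← sub_smul, sum_inner, inner_smul_left,
        inner_sub_right, conj_trivial]
      exact Finset.sum_congr rfl fun i _ => by ring
    have h2 : ∀ i, 0 ≤ (T (inner ℝ (v i) x) - T (inner ℝ (v i) y)) *
        (inner ℝ (v i) x - inner ℝ (v i) y) := by
      intro i
      rcases le_total (inner ℝ (v i) x) (inner ℝ (v i) y) with h | h
      · exact mul_nonneg_of_nonpos_of_nonpos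
          (sub_nonpos.2 ((hTm.le_iff_le (hx i) (hy i)).2 h)) (sub_nonpos.2 h)
      · exact mul_nonneg (sub_nonneg.2 ((hTm.le_iff_le (hy i) (hx i)).2 h)) (sub_nonneg.2 h)
    rw [h1, Finset.sum_eq_zero_iff_of_nonneg fun i _ => mul_nonneg (hc i) (h2 i)] at h0
    have h3 : ‖x - y‖ ^ 2 = 0 := by
      rw [← hI]
      refine Finset.sum_eq_zero fun i hi => ?_
      rcases mul_eq_zero.1 (h0 i hi) with h | h
      · rw [h, zero_mul]
      · have : inner ℝ (v i) x = inner ℝ (v i) y := by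
          rcases mul_eq_zero.1 h with h | h
          · exact hTm.injOn (hx i) (hy i) (sub_eq_zero.1 h)
          · exact sub_eq_zero.1 h
        rw [inner_sub_right, this, sub_self]
        ring
    exact sub_eq_zero.1 (norm_eq_zero.1 (pow_eq_zero_iff two_ne_zero |>.1 h3))
  -- Multiply the one-dimensional transport identities raised to the powers c_i. The product of the
  -- derivatives is at most the Jacobian, and ‖S x‖² ≤ ∑ c_i T_i² enlarges the Gaussian factor.
  have hpt : ∀ x ∈ s, ENNReal.ofReal (Real.exp (-∑ i, c i * inner ℝ (v i) x)) ≤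
      ENNReal.ofReal |(S' x).det| * ENNReal.ofReal (Real.exp (-Real.pi * ‖S x‖ ^ 2)) := by
    intro x hx
    rw [← ENNReal.ofReal_mul (abs_nonneg _)]
    refine ENNReal.ofReal_le_ofReal ?_
    have e1 : Real.exp (-∑ i, c i * inner ℝ (v i) x) =
        Real.exp (-Real.pi * ∑ i, c i * T (inner ℝ (v i) x) ^ 2) *
          ∏ i, T' (inner ℝ (v i) x) ^ c i := by
      rw [Finset.mul_sum, Real.exp_sum, ← Finset.prod_mul_distrib, ← Finset.sum_neg_distrib,
        Real.exp_sum]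
      refine Finset.prod_congr rfl fun i _ => ?_
      obtain ⟨-, hp, he⟩ := hT _ (hx i)
      rw [show -(c i * inner ℝ (v i) x) = -inner ℝ (v i) x * c i by ring, Real.exp_mul, he,
        Real.mul_rpow (Real.exp_pos _).le hp.le, ← Real.exp_mul]
      ring_nf
    rw [e1, mul_comm]
    have h1 := prod_rpow_le_det_sum_smulRight v c (fun i => T' (inner ℝ (v i) x)) hc
      (fun i => (hT _ (hx i)).2.1) hv hI
    have h2 := norm_sum_smul_sq_le v c (fun i => T (inner ℝ (v i) x)) hc hI
    refine mul_le_mul (h1.trans (le_abs_self _)) (Real.exp_le_exp.2 ?_) (Real.exp_pos _).le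
      (abs_nonneg _)
    nlinarith [Real.pi_pos]
  calc ∫⁻ x in s, ENNReal.ofReal (Real.exp (-∑ i, c i * inner ℝ (v i) x))
      ≤ ∫⁻ x in s, ENNReal.ofReal |(S' x).det| *
          ENNReal.ofReal (Real.exp (-Real.pi * ‖S x‖ ^ 2)) := setLIntegral_mono' hsm hpt
    _ = ∫⁻ y in S '' s, ENNReal.ofReal (Real.exp (-Real.pi * ‖y‖ ^ 2)) :=
        (lintegral_image_eq_lintegral_abs_det_fderiv_mul volume hsm hS hinj
          fun y => ENNReal.ofReal (Real.exp (-Real.pi * ‖y‖ ^ 2))).symm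
    _ ≤ ∫⁻ y : F, ENNReal.ofReal (Real.exp (-Real.pi * ‖y‖ ^ 2)) := setLIntegral_le_lintegral _ _
    _ = 1 := by
        have h1 := GaussianFourier.integral_rexp_neg_mul_sq_norm (V := F) Real.pi_pos
        rw [div_self Real.pi_ne_zero, Real.one_rpow] at h1
        rw [← ofReal_integral_eq_lintegral_ofReal, h1, ENNReal.ofReal_one]
        · exact not_not.1 fun h => one_ne_zero (h1.symm.trans (integral_undef h))
        · exact Filter.Eventually.of_forall fun _ => (Real.exp_pos _).le

end BrascampLieb

/-! ### John's decomposition of the identity at the contact points. -/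

section John

/-- The convex hull of a compact set in a finite-dimensional space is compact. -/
theorem IsCompact.isCompact_convexHull {V : Type*} [NormedAddCommGroup V] [NormedSpace ℝ V]
    [FiniteDimensional ℝ V] {s : Set V} (hs : IsCompact s) : IsCompact (convexHull ℝ s) := by
  classical
  rcases s.eq_empty_or_nonempty with rfl | ⟨a, ha⟩
  · simp
  -- Carathéodory: d points suffice, so the hull is a continuous image of a compact product. Shorter
  -- combinations are padded with the point `a` at weight 0.
  let d := Module.finrank ℝ V + 1
  let Φ : (Fin d → ℝ) × (Fin d → V) → V := fun p => ∑ i, p.1 i • p.2 i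
  have hΦ : Continuous Φ := by fun_prop
  have hK : IsCompact (stdSimplex ℝ (Fin d) ×ˢ Set.univ.pi fun _ : Fin d => s) :=
    (isCompact_stdSimplex ℝ (Fin d)).prod (isCompact_univ_pi fun _ => hs)
  convert! hK.image hΦ using 1
  refine Set.Subset.antisymm (fun x hx => ?_) ?_
  · obtain ⟨ι, _, z, w, hz, hind, hw, hw1, rfl⟩ := eq_pos_convex_span_of_mem_convexHull hx
    have hcard : Fintype.card ι ≤ Fintype.card (Fin d) := by
      rw [Fintype.card_fin]
      exact hind.card_le_finrank_succ.trans (Nat.succ_le_succ (Submodule.finrank_le _))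
    obtain ⟨e⟩ := Function.Embedding.nonempty_of_card_le hcard
    have hw' : ∀ i, Function.extend e w 0 (e i) = w i := fun i => e.injective.extend_apply _ _ _
    have hz' : ∀ i, Function.extend e z (fun _ => a) (e i) = z i :=
      fun i => e.injective.extend_apply _ _ _
    have hout : ∀ j, j ∉ Set.range e → Function.extend e w 0 j = 0 :=
      fun j hj => Function.extend_apply' _ _ _ hj
    refine ⟨(Function.extend e w 0, Function.extend e z fun _ => a), ⟨⟨fun j => ?_, ?_⟩, fun j _ => ?_⟩, ?_⟩
    · by_cases hj : ∃ i, e i = j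
      · obtain ⟨i, rfl⟩ := hj
        exact (hw i).le.trans_eq (hw' i).symm
      · exact (hout j hj).ge
    · rw [← hw1]
      exact (Fintype.sum_of_injective e e.injective _ _ hout fun i => (hw' i).symm).symm
    · by_cases hj : ∃ i, e i = j
      · obtain ⟨i, rfl⟩ := hj
        simp only [hz']
        exact hz ⟨i, rfl⟩
      · simp only [Function.extend_apply' _ _ _ hj]
        exact ha
    · refine (Fintype.sum_of_injective e e.injective _ _ (fun j hj => ?_) fun i => ?_).symm
      · simp only [hout j hj, zero_smul]
      · simp only [hw', hz']
  · rintro _ ⟨⟨w, z⟩, ⟨⟨hw0, hw1⟩, hz⟩, rfl⟩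
    exact mem_convexHull_of_exists_fintype w z hw0 hw1 (fun i => hz i (Set.mem_univ i)) rfl

/-- At a contact point `u` of a convex set with its inscribed unit ball, the supporting halfspace
is `⟪u, x⟫ ≤ 1`. -/
theorem inner_lt_one_of_mem_interior {E : Type*} [NormedAddCommGroup E] [InnerProductSpace ℝ E]
    [CompleteSpace E] {C : Set E} (hC : Convex ℝ C) (hB : Metric.closedBall 0 1 ⊆ C) {u : E}
    (hu : ‖u‖ = 1) (huC : u ∉ interior C) {x : E} (hx : x ∈ interior C) : inner ℝ u x < 1 := by
  obtain ⟨f, hf⟩ := geometric_hahn_banach_open_point hC.interior isOpen_interior huC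
  set w : E := (InnerProductSpace.toDual ℝ E).symm f with hw
  have hfw : ∀ y, f y = inner ℝ w y := fun y => by simp [hw]
  have hball : Metric.ball (0 : E) 1 ⊆ interior C :=
    interior_maximal (Metric.ball_subset_closedBall.trans hB) Metric.isOpen_ball
  have hpos : 0 < f u := by
    have h := hf 0 (hball (by simp))
    rwa [map_zero] at h
  have hle : ‖w‖ ≤ inner ℝ w u := by
    by_contra! hlt
    have hwpos : 0 < ‖w‖ := by
      rw [hfw] at hpos
      linarith
    have ht0 : 0 < inner ℝ w u / ‖w‖ := by
      rw [← hfw]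
      positivity
    -- This multiple of `w` has the same value under `f` as `u`, but norm ⟪w, u⟫/‖w‖ < 1, so it is
    -- interior to `C`. Hence Cauchy-Schwarz is an equality and `w` is a positive multiple of `u`.
    have h := hf ((inner ℝ w u / ‖w‖ ^ 2) • w) (hball ?_)
    · rw [map_smul, hfw, hfw, real_inner_self_eq_norm_sq, smul_eq_mul,
        div_mul_cancel₀ _ (by positivity)] at h
      exact lt_irrefl _ h
    · rw [mem_ball_zero_iff, norm_smul, Real.norm_eq_abs, abs_of_pos (by rw [← hfw]; positivity),
        pow_two, div_mul_eq_mul_div, mul_div_mul_right _ _ hwpos.ne', div_lt_one hwpos]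
      exact hlt
  have hwu : w = ‖w‖ • u := by
    have h1 : inner ℝ w u = ‖w‖ * ‖u‖ :=
      le_antisymm (real_inner_le_norm _ _) (by rwa [hu, mul_one])
    have h2 := inner_eq_norm_mul_iff_real.1 h1
    rw [hu, one_smul] at h2
    exact h2
  have hlt := hf x hx
  rw [hfw, hfw, hwu, inner_smul_left, inner_smul_left, real_inner_self_eq_norm_sq, hu] at hlt
  simp only [conj_trivial, one_pow, mul_one] at hlt
  have hwpos : 0 < ‖w‖ := by
    rw [hfw] at hpos
    exact hpos.trans_le ((real_inner_le_norm _ _).trans (by rw [hu, mul_one]))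
  nlinarith

open Filter Topology in
/-- A perturbation of the unit ball that moves the contact points inwards stays in `C`. -/
theorem eventually_perturbed_ball_subset {E : Type*} [NormedAddCommGroup E]
    [InnerProductSpace ℝ E] [FiniteDimensional ℝ E] {C : Set E}
    (hB : Metric.closedBall 0 1 ⊆ C) (W : E →L[ℝ] E) (z : E) {ε : ℝ} (hε : 0 < ε)
    (h : ∀ u, ‖u‖ = 1 → u ∉ interior C → ε ≤ inner ℝ u (W u + z)) :
    ∀ᶠ δ : ℝ in 𝓝[>] 0, ∀ x ∈ Metric.closedBall (0 : E) 1, x - δ • (W x + z) ∈ C := by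
  -- `K` is compact and contains no contact points, so a uniform neighbourhood of it lies in `C`.
  -- Off `K` the moved point stays in the ball: its squared norm is at most 1 - δε + δ²M².
  set K : Set E := Metric.closedBall 0 1 ∩ {x | inner ℝ x (W x + z) ≤ ε / 2} with hKdef
  have hball : Metric.ball (0 : E) 1 ⊆ interior C :=
    interior_maximal (Metric.ball_subset_closedBall.trans hB) Metric.isOpen_ball
  have hK : IsCompact K := (isCompact_closedBall _ _).inter_right
    (isClosed_le (by fun_prop) continuous_const)
  have hKC : K ⊆ interior C := by
    rintro x ⟨hx1, hx2⟩
    rw [mem_closedBall_zero_iff] at hx1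
    by_contra hxC
    have hx : ‖x‖ = 1 := le_antisymm hx1 (not_lt.1 fun hlt => hxC (hball (by simpa using hlt)))
    have := h x hx hxC
    simp only [Set.mem_ofPred_eq] at hx2
    linarith
  obtain ⟨r, hr, hrC⟩ := hK.exists_thickening_subset_open isOpen_interior hKC
  set M : ℝ := ‖W‖ + ‖z‖
  have hM : ∀ x ∈ Metric.closedBall (0 : E) 1, ‖W x + z‖ ≤ M := fun x hx =>
    (norm_add_le _ _).trans (add_le_add_left
      ((W.le_opNorm x).trans (mul_le_of_le_one_right (norm_nonneg _) (by simpa using hx))) _)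
  have e1 : ∀ᶠ δ : ℝ in 𝓝[>] 0, δ * M < r := by
    have : Tendsto (fun δ : ℝ => δ * M) (𝓝[>] 0) (𝓝 (0 * M)) :=
      (Continuous.tendsto (by fun_prop) _).mono_left nhdsWithin_le_nhds
    rw [zero_mul] at this
    exact this.eventually_lt_const hr
  have e2 : ∀ᶠ δ : ℝ in 𝓝[>] 0, δ * M ^ 2 < ε := by
    have : Tendsto (fun δ : ℝ => δ * M ^ 2) (𝓝[>] 0) (𝓝 (0 * M ^ 2)) :=
      (Continuous.tendsto (by fun_prop) _).mono_left nhdsWithin_le_nhds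
    rw [zero_mul] at this
    exact this.eventually_lt_const hε
  filter_upwards [e1, e2, self_mem_nhdsWithin] with δ h1 h2 hδ x hx
  have hδ : 0 < δ := hδ
  have hMx := hM x hx
  by_cases hxK : inner ℝ x (W x + z) ≤ ε / 2
  · refine interior_subset (hrC (Metric.mem_thickening_iff.2 ⟨x, ⟨hx, hxK⟩, ?_⟩))
    rw [dist_eq_norm, sub_sub_cancel_left, norm_neg, norm_smul, Real.norm_of_nonneg hδ.le]
    exact (mul_le_mul_of_nonneg_left hMx hδ.le).trans_lt h1
  · refine hB ?_
    rw [mem_closedBall_zero_iff] at hx ⊢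
    rw [← sq_le_one_iff₀ (norm_nonneg _), norm_sub_sq_real, inner_smul_right, norm_smul,
      Real.norm_of_nonneg hδ.le, mul_pow]
    push Not at hxK
    have h3 : ‖W x + z‖ ^ 2 ≤ M ^ 2 := by gcongr
    have h4 : ‖x‖ ^ 2 ≤ 1 := pow_le_one₀ (norm_nonneg _) hx
    have h5 : δ ^ 2 * ‖W x + z‖ ^ 2 ≤ δ * (δ * M ^ 2) := by
      rw [pow_two, mul_assoc]
      gcongr
    have h6 : δ * (δ * M ^ 2) ≤ δ * ε := by gcongr
    have h7 : δ * (ε / 2) ≤ δ * inner ℝ x (W x + z) := by gcongr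
    linarith

theorem isEllipsoid_image_of_det_ne_zero {n : ℕ}
    (A : EuclideanSpace ℝ (Fin n) →L[ℝ] EuclideanSpace ℝ (Fin n)) (hA : A.det ≠ 0)
    (c : EuclideanSpace ℝ (Fin n)) :
    IsEllipsoid ((fun x => A x + c) '' Metric.closedBall 0 1) := by
  refine ⟨(A.toContinuousLinearEquivOfDetNeZero hA).toLinearEquiv.toAffineEquiv.trans
    (AffineEquiv.constVAdd ℝ _ c), Set.image_congr fun x _ => ?_⟩
  simp [add_comm]

-- First-order expansion det(1 - δM) = 1 - δ tr M + O(δ²), with a polynomial remainder `q`.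
open Filter Topology in
theorem Matrix.eventually_one_lt_det_one_sub_smul {m : Type*} [Fintype m] [DecidableEq m]
    (M : Matrix m m ℝ) (hM : M.trace < 0) : ∀ᶠ δ : ℝ in 𝓝[>] 0, 1 < (1 - δ • M).det := by
  set q := (Matrix.det (1 + (Polynomial.X : Polynomial ℝ) • M.map Polynomial.C)).divX.divX
  have h1 : Tendsto (fun δ : ℝ => -M.trace + q.eval (-δ) * δ) (𝓝[>] 0)
      (𝓝 (-M.trace + q.eval (-0) * 0)) :=
    (Continuous.tendsto (by fun_prop) _).mono_left nhdsWithin_le_nhds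
  rw [mul_zero, add_zero] at h1
  filter_upwards [h1.eventually_const_lt (neg_pos.2 hM), self_mem_nhdsWithin] with δ h2 hδ
  have h3 := Matrix.det_one_add_smul (-δ) M
  rw [neg_smul, ← sub_eq_add_neg] at h3
  rw [h3]
  nlinarith [mul_pos (show 0 < δ from hδ) h2]

theorem det_toEuclideanCLM {n : ℕ} (M : Matrix (Fin n) (Fin n) ℝ) :
    (Matrix.toEuclideanCLM (𝕜 := ℝ) M).det = M.det := by
  change LinearMap.det (Matrix.toEuclideanLin M) = _
  rw [Matrix.toEuclideanLin_eq_toLin_orthonormal, LinearMap.det_toLin]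

/-- **John's theorem**: if the unit ball is an ellipsoid of maximal volume in `C`, the contact
points decompose the identity. -/
theorem IsMaximalEllipsoid.exists_john_decomposition {n : ℕ} (hn : 1 ≤ n)
    {C : Set (EuclideanSpace ℝ (Fin n))} (hC : Convex ℝ C)
    (hmax : IsMaximalEllipsoid C (Metric.closedBall 0 1)) :
    ∃ (ι : Type) (_ : Fintype ι) (u : ι → EuclideanSpace ℝ (Fin n)) (c : ι → ℝ),
      (∀ i, 0 ≤ c i) ∧ (∀ i, ‖u i‖ = 1) ∧ (∀ i, ∀ x ∈ interior C, inner ℝ (u i) x < 1) ∧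
      (∀ x, ∑ i, c i * inner ℝ (u i) x ^ 2 = ‖x‖ ^ 2) ∧ ∑ i, c i • u i = 0 ∧
      ∑ i, c i = n := by
  have hn0 : (0 : ℝ) < n := by exact_mod_cast hn
  -- The decomposition says that (I/n, 0) is a convex combination of the points (u ⊗ u, u).
  -- Otherwise a separating functional (H, z) would yield a larger ellipsoid in `C`.
  let φ : EuclideanSpace ℝ (Fin n) → (Fin n → Fin n → ℝ) × (EuclideanSpace ℝ (Fin n)) := fun u => (fun i j => u i * u j, u)
  have hφ : Continuous φ := by fun_prop
  set K : Set (EuclideanSpace ℝ (Fin n)) := Metric.sphere 0 1 ∩ (interior C)ᶜ with hKdef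
  have hK : IsCompact K := (isCompact_sphere _ _).inter_right isOpen_interior.isClosed_compl
  have hmem : ((fun i j => if i = j then (n : ℝ)⁻¹ else 0, 0) : (Fin n → Fin n → ℝ) × (EuclideanSpace ℝ (Fin n))) ∈
      convexHull ℝ (φ '' K) := by
    by_contra hp
    obtain ⟨f, s, hfp, hfs⟩ := geometric_hahn_banach_point_closed (convex_convexHull ℝ _)
      (hK.image hφ).isCompact_convexHull.isClosed hp
    let H : Matrix (Fin n) (Fin n) ℝ := Matrix.of fun i j => f (Pi.single i (Pi.single j 1), 0)
    let z : EuclideanSpace ℝ (Fin n) := (InnerProductSpace.toDual ℝ (EuclideanSpace ℝ (Fin n))).symm (f.comp (ContinuousLinearMap.inr ℝ _ (EuclideanSpace ℝ (Fin n))))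
    have hf : ∀ M u, f (M, u) = ∑ i, ∑ j, M i j * H i j + inner ℝ z u := by
      intro M u
      have h1 : f (0, u) = inner ℝ z u := by simp [z]
      have h2 : M = ∑ i, ∑ j, M i j • Pi.single i (Pi.single j (1 : ℝ)) := by
        ext a b
        simp [Finset.sum_apply, Pi.single_apply, Finset.sum_ite_eq, ite_apply]
      have h3 : f (M, 0) = ∑ i, ∑ j, M i j * H i j := by
        change (f.comp (ContinuousLinearMap.inl ℝ (Fin n → Fin n → ℝ) (EuclideanSpace ℝ (Fin n)))) M = _
        conv_lhs => rw [h2]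
        simp [H]
      rw [← h1, ← h3, ← map_add]
      simp
    set p := f ((fun i j => if i = j then (n : ℝ)⁻¹ else 0), 0) with hpdef
    have htr : H.trace = n * p := by
      rw [hpdef, hf]
      simp [Matrix.trace, ← Finset.mul_sum, hn0.ne']
    -- The midpoint of p < s: subtracting s' I from H makes the trace n(p - s') negative, so the
    -- volume grows, while contact points still move inwards by at least s - s' > 0.
    set s' := (s + p) / 2 with hs'
    set W : Matrix (Fin n) (Fin n) ℝ := H - s' • 1 with hW
    have hWtr : W.trace < 0 := by
      rw [hW, Matrix.trace_sub, Matrix.trace_smul, Matrix.trace_one, htr, Fintype.card_fin,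
        smul_eq_mul]
      nlinarith
    have hcontact : ∀ u : EuclideanSpace ℝ (Fin n), ‖u‖ = 1 → u ∉ interior C →
        s - s' ≤ inner ℝ u (Matrix.toEuclideanCLM (𝕜 := ℝ) W u + z) := by
      intro u hu huC
      have h1 := hfs (φ u) (subset_convexHull ℝ _ ⟨u, ⟨by simpa using hu, huC⟩, rfl⟩)
      have h2 : inner ℝ u (Matrix.toEuclideanCLM (𝕜 := ℝ) H u) = ∑ i, ∑ j, u i * u j * H i j := by
        simp only [PiLp.inner_apply, Matrix.ofLp_toEuclideanCLM, Matrix.mulVec, dotProduct,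
          RCLike.inner_apply, conj_trivial, Finset.sum_mul]
        exact Finset.sum_congr rfl fun i _ => Finset.sum_congr rfl fun j _ => by ring
      have h3 : inner ℝ u (Matrix.toEuclideanCLM (𝕜 := ℝ) W u + z) = f (φ u) - s' := by
        rw [hW, map_sub, map_smul, map_one, inner_add_right, sub_apply,
          inner_sub_right, h2, smul_apply, one_apply_eq_self,
          inner_smul_right, real_inner_self_eq_norm_sq, hu, hf, real_inner_comm]
        ring
      linarith
    have hsub := eventually_perturbed_ball_subset hmax.subset (Matrix.toEuclideanCLM (𝕜 := ℝ) W) z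
      (show 0 < s - s' by linarith) hcontact
    obtain ⟨δ, hδ1, hδ2⟩ := (hsub.and (Matrix.eventually_one_lt_det_one_sub_smul W hWtr)).exists
    let A := Matrix.toEuclideanCLM (𝕜 := ℝ) (1 - δ • W)
    have hA : A.det = (1 - δ • W).det := det_toEuclideanCLM _
    have hvol := hmax.volume_le _
      (isEllipsoid_image_of_det_ne_zero A (by rw [hA]; linarith) (-(δ • z))) ?_
    · rw [volume_affine_image_ball, hA, abs_of_pos (by linarith)] at hvol
      have hB0 : volume (Metric.closedBall (0 : EuclideanSpace ℝ (Fin n)) 1) ≠ 0 :=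
        (Metric.measure_closedBall_pos volume _ one_pos).ne'
      have hB1 : volume (Metric.closedBall (0 : EuclideanSpace ℝ (Fin n)) 1) ≠ ⊤ := measure_closedBall_lt_top.ne
      have h1 : (1 : ENNReal) * volume (Metric.closedBall (0 : EuclideanSpace ℝ (Fin n)) 1) <
          ENNReal.ofReal (1 - δ • W).det * volume (Metric.closedBall (0 : EuclideanSpace ℝ (Fin n)) 1) :=
        ENNReal.mul_lt_mul_left hB0 hB1 (ENNReal.one_lt_ofReal.2 hδ2)
      rw [one_mul] at h1
      exact absurd hvol (not_le.2 h1)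
    · rintro _ ⟨x, hx, rfl⟩
      have h1 := hδ1 x hx
      convert! h1 using 1
      simp only [A, map_sub, map_one, map_smul, sub_apply,
        one_apply_eq_self, smul_apply, smul_add]
      abel
  obtain ⟨ι, _, w, y, hw0, hw1, hy, hsum⟩ := mem_convexHull_iff_exists_fintype.1 hmem
  choose u huK huy using hy
  have hsum1 : ∀ a b, ∑ i, w i * (u i a * u i b) = if a = b then (n : ℝ)⁻¹ else 0 := by
    intro a b
    have h := congrFun (congrFun (congrArg Prod.fst hsum) a) b
    simpa [← huy, φ, Prod.fst_sum, Finset.sum_apply] using h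
  have hsum2 : ∑ i, w i • u i = 0 := by
    have h := congrArg Prod.snd hsum
    simpa [← huy, φ, Prod.snd_sum] using h
  -- The factor n turns I/n into I and the total weight 1 into n.
  refine ⟨ι, inferInstance, u, fun i => n * w i, fun i => mul_nonneg hn0.le (hw0 i),
    fun i => by simpa using (huK i).1, fun i x hx =>
      inner_lt_one_of_mem_interior hC hmax.subset (by simpa using (huK i).1) (huK i).2 hx, ?_, ?_, ?_⟩
  · intro x
    have h1 : ∀ i, inner ℝ (u i) x ^ 2 = ∑ a, ∑ b, (u i a * u i b) * (x a * x b) := by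
      intro i
      rw [pow_two, PiLp.inner_apply, Finset.sum_mul_sum]
      exact Finset.sum_congr rfl fun a _ => Finset.sum_congr rfl fun b _ => by
        simp only [RCLike.inner_apply, conj_trivial]; ring
    calc ∑ i, n * w i * inner ℝ (u i) x ^ 2
        = n * ∑ a, ∑ b, (∑ i, w i * (u i a * u i b)) * (x a * x b) := by
          simp only [h1, Finset.sum_mul, Finset.mul_sum]
          rw [Finset.sum_comm]
          refine Finset.sum_congr rfl fun a _ => ?_
          rw [Finset.sum_comm]
          exact Finset.sum_congr rfl fun b _ => Finset.sum_congr rfl fun i _ => by ring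
      _ = ‖x‖ ^ 2 := by
          simp only [hsum1, ite_mul, zero_mul, Finset.sum_ite_eq, Finset.mem_univ, if_true,
            EuclideanSpace.real_norm_sq_eq, ← Finset.mul_sum]
          rw [mul_inv_cancel_left₀ hn0.ne']
          exact Finset.sum_congr rfl fun a _ => by ring
  · simp only [mul_smul, ← Finset.smul_sum, hsum2, smul_zero]
  · rw [← Finset.mul_sum, hw1, mul_one]

end John

/-! ### Exponential integrals over cones. -/

section Cone

variable {E : Type*} [NormedAddCommGroup E] [InnerProductSpace ℝ E] [FiniteDimensional ℝ E]
  [MeasurableSpace E] [BorelSpace E]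

theorem lintegral_Ioi_pow_mul_exp_neg (n : ℕ) {l : ℝ} (hl : 0 < l) :
    ∫⁻ r in Set.Ioi (0 : ℝ), ENNReal.ofReal (r ^ n * Real.exp (-(l * r))) =
      ENNReal.ofReal (n.factorial / l ^ (n + 1)) := by
  have h := Real.integral_rpow_mul_exp_neg_mul_Ioi (a := n + 1) (by positivity) hl
  simp only [add_sub_cancel_right, Real.rpow_natCast, Real.Gamma_nat_eq_factorial] at h
  have h1 : (1 / l) ^ ((n : ℝ) + 1) = 1 / l ^ (n + 1) := by
    rw [← Nat.cast_succ, Real.rpow_natCast, one_div_pow]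
  rw [h1, one_div_mul_eq_div] at h
  rw [← ofReal_integral_eq_lintegral_ofReal, h]
  · refine not_not.1 fun hi => ?_
    rw [integral_undef hi] at h
    have : 0 < (n.factorial : ℝ) / l ^ (n + 1) := by positivity
    exact this.ne h
  · exact (ae_restrict_iff' measurableSet_Ioi).2 (Filter.Eventually.of_forall fun r hr =>
      mul_nonneg (pow_nonneg (Set.mem_Ioi.1 hr).le _) (Real.exp_pos _).le)

/-- Integration of an exponential over the cone spanned by `s • K` at height one. -/
theorem lintegral_cone_exp_neg {K : Set E} (hK : MeasurableSet K) {s l : ℝ} (hs : 0 < s)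
    (hl : 0 < l) :
    ∫⁻ x in {x : WithLp 2 (E × ℝ) | 0 < x.snd ∧ (s * x.snd)⁻¹ • x.fst ∈ K},
      ENNReal.ofReal (Real.exp (-(l * x.snd))) =
    ENNReal.ofReal (s ^ Module.finrank ℝ E * (Module.finrank ℝ E).factorial /
      l ^ (Module.finrank ℝ E + 1)) * volume K := by
  set d := Module.finrank ℝ E
  let D : Set (E × ℝ) := {p | 0 < p.2 ∧ (s * p.2)⁻¹ • p.1 ∈ K}
  have hD : MeasurableSet D := by
    have h1 : MeasurableSet {p : E × ℝ | 0 < p.2} := measurableSet_lt measurable_const measurable_snd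
    have h2 : Measurable fun p : E × ℝ => (s * p.2)⁻¹ • p.1 := by fun_prop
    exact h1.inter (h2 hK)
  have hg : Measurable fun p : E × ℝ => ENNReal.ofReal (Real.exp (-(l * p.2))) := by fun_prop
  have h1 : ∫⁻ x in {x : WithLp 2 (E × ℝ) | 0 < x.snd ∧ (s * x.snd)⁻¹ • x.fst ∈ K},
      ENNReal.ofReal (Real.exp (-(l * x.snd))) =
      ∫⁻ p in D, ENNReal.ofReal (Real.exp (-(l * p.2))) :=
    (WithLp.volume_preserving_ofLp E ℝ).setLIntegral_comp_preimage hD hg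
  rw [h1, ← lintegral_indicator hD, Measure.volume_eq_prod,
    lintegral_prod_symm' _ (hg.indicator hD)]
  -- The slice of the cone at height r > 0 is (s r)K, of volume (s r)^d |K|.
  have h2 : ∀ r : ℝ, ∫⁻ y : E, D.indicator (fun p => ENNReal.ofReal (Real.exp (-(l * p.2)))) (y, r) =
      (Set.Ioi (0 : ℝ)).indicator (fun r => ENNReal.ofReal (s ^ d) * volume K *
        ENNReal.ofReal (r ^ d * Real.exp (-(l * r)))) r := by
    intro r
    by_cases hr : 0 < r
    · rw [Set.indicator_of_mem (Set.mem_Ioi.2 hr)]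
      have h3 : ∀ y : E, D.indicator (fun p => ENNReal.ofReal (Real.exp (-(l * p.2)))) (y, r) =
          ((fun y => (s * r)⁻¹ • y) ⁻¹' K).indicator
            (fun _ => ENNReal.ofReal (Real.exp (-(l * r)))) y := by
        intro y
        by_cases hy : (s * r)⁻¹ • y ∈ K
        · rw [Set.indicator_of_mem (show (y, r) ∈ D from ⟨hr, hy⟩), Set.indicator_of_mem (by exact hy)]
        · rw [Set.indicator_of_notMem fun h => hy h.2, Set.indicator_of_notMem (by exact hy)]
      have hm : MeasurableSet ((fun y : E => (s * r)⁻¹ • y) ⁻¹' K) :=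
        (show Measurable fun y : E => (s * r)⁻¹ • y by fun_prop) hK
      simp only [h3]
      rw [lintegral_indicator_const hm, Measure.addHaar_preimage_smul _ (by positivity), inv_pow,
        inv_inv, abs_of_pos (by positivity), mul_pow, ENNReal.ofReal_mul (by positivity),
        ENNReal.ofReal_mul (by positivity)]
      ring
    · rw [Set.indicator_of_notMem (by simpa using hr)]
      simp [Set.indicator, D, hr]
  simp only [h2]
  rw [lintegral_indicator measurableSet_Ioi, lintegral_const_mul _ (by fun_prop),
    lintegral_Ioi_pow_mul_exp_neg d hl, mul_right_comm, ← ENNReal.ofReal_mul (by positivity),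
    mul_div_assoc]

end Cone

/-! ### Upper bound for bodies whose maximal ellipsoid is the unit ball. -/

/-- The volume of a regular simplex circumscribed to the unit ball of `ℝⁿ`. -/
noncomputable def regularSimplexVolume (n : ℕ) : ℝ :=
  √n ^ n * √(n + 1) ^ (n + 1) / n.factorial

theorem regularSimplexVolume_eq (n : ℕ) : regularSimplexVolume n =
    (n : ℝ) ^ ((n : ℝ) / 2) * ((n : ℝ) + 1) ^ (((n : ℝ) + 1) / 2) / (n.factorial : ℝ) := by
  rw [regularSimplexVolume, Real.sqrt_eq_rpow, Real.sqrt_eq_rpow, ← Real.rpow_mul_natCast (by positivity),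
    ← Real.rpow_mul_natCast (by positivity)]
  push_cast
  rw [one_div_mul_eq_div, one_div_mul_eq_div]

/-- A convex set whose maximal ellipsoid is the unit ball is at most as large as the
circumscribed regular simplex. -/
theorem IsMaximalEllipsoid.volume_le_regularSimplexVolume {n : ℕ} (hn : 1 ≤ n)
    {C : Set (EuclideanSpace ℝ (Fin n))} (hC : Convex ℝ C)
    (hmax : IsMaximalEllipsoid C (Metric.closedBall 0 1)) :
    volume C ≤ ENNReal.ofReal (regularSimplexVolume n) := by
  obtain ⟨ι, _, u, c, hc, hu, huC, hI, hsum, hcn⟩ := hmax.exists_john_decomposition hn hC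
  have hn0 : (0 : ℝ) < n := by exact_mod_cast hn
  set p : ℝ := √n with hp
  set q : ℝ := √(n + 1) with hq
  have hp0 : 0 < p := Real.sqrt_pos.2 hn0
  have hq0 : 0 < q := Real.sqrt_pos.2 (by positivity)
  have hp2 : p ^ 2 = n := Real.sq_sqrt hn0.le
  have hq2 : q ^ 2 = n + 1 := Real.sq_sqrt (by positivity)
  let v : ι → WithLp 2 (EuclideanSpace ℝ (Fin n) × ℝ) := fun i =>
    WithLp.toLp 2 (-(p / q) • u i, 1 / q)
  have hvx : ∀ i x, inner ℝ (v i) x = (x.snd - p * inner ℝ (u i) x.fst) / q := by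
    intro i x
    simp only [v, WithLp.prod_inner_apply, inner_smul_left, RCLike.inner_apply, conj_trivial]
    field_simp
    ring_nf
    rfl
  have hv : ∀ i, ‖v i‖ = 1 := by
    intro i
    rw [← sq_eq_sq₀ (norm_nonneg _) zero_le_one, WithLp.prod_norm_sq_eq_of_L2]
    change ‖-(p / q) • u i‖ ^ 2 + ‖1 / q‖ ^ 2 = 1 ^ 2
    simp only [norm_smul, hu, norm_neg, Real.norm_eq_abs, mul_one, sq_abs, div_pow, hp2, hq2]
    field_simp
  have hsum' : ∀ y, ∑ i, c i * inner ℝ (u i) y = 0 := by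
    intro y
    have h : inner ℝ (∑ i, c i • u i) y = 0 := by rw [hsum, inner_zero_left]
    simpa [sum_inner, inner_smul_left] using h
  -- The factor (n + 1)/n matches the trace: unit vectors decomposing the identity of ℝⁿ⁺¹ have
  -- total weight n + 1. Cross terms in `hI'` vanish by ∑ c_i u_i = 0.
  let c' : ι → ℝ := fun i => (q / p) ^ 2 * c i
  have hI' : ∀ x : WithLp 2 (EuclideanSpace ℝ (Fin n) × ℝ),
      ∑ i, c' i * inner ℝ (v i) x ^ 2 = ‖x‖ ^ 2 := by
    intro x
    have h1 : ∀ i, c' i * inner ℝ (v i) x ^ 2 = x.snd ^ 2 / p ^ 2 * c i -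
        2 * x.snd / p * (c i * inner ℝ (u i) x.fst) + c i * inner ℝ (u i) x.fst ^ 2 := by
      intro i
      rw [hvx]
      simp only [c']
      field_simp
      ring
    simp only [h1, Finset.sum_add_distrib, Finset.sum_sub_distrib, ← Finset.mul_sum, hI, hcn, hsum']
    rw [WithLp.prod_norm_sq_eq_of_L2, hp2, Real.norm_eq_abs, sq_abs]
    field_simp
    ring
  have hlin : ∀ x, ∑ i, c' i * inner ℝ (v i) x = q * x.snd := by
    intro x
    have h1 : ∀ i, c' i * inner ℝ (v i) x = q * x.snd / p ^ 2 * c i -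
        q / p * (c i * inner ℝ (u i) x.fst) := by
      intro i
      rw [hvx]
      simp only [c']
      field_simp
    simp only [h1, Finset.sum_sub_distrib, ← Finset.mul_sum, hcn, hsum']
    rw [hp2]
    field_simp
    ring
  have hBL := lintegral_exp_neg_sum_inner_le_one v c'
    (fun i => mul_nonneg (by positivity) (hc i)) hv hI'
  simp only [hlin] at hBL
  have hcone := lintegral_cone_exp_neg (K := interior C) isOpen_interior.measurableSet
    (inv_pos.2 hp0) hq0
  rw [finrank_euclideanSpace_fin] at hcone
  have hsub : {x : WithLp 2 (EuclideanSpace ℝ (Fin n) × ℝ) |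
      0 < x.snd ∧ (p⁻¹ * x.snd)⁻¹ • x.fst ∈ interior C} ⊆ {x | ∀ i, 0 < inner ℝ (v i) x} := by
    rintro x ⟨hr, hx⟩ i
    have h1 := huC i _ hx
    rw [inner_smul_right, inv_mul_lt_iff₀ (by positivity), mul_one, inv_mul_eq_div,
      lt_div_iff₀' hp0] at h1
    rw [hvx]
    exact div_pos (sub_pos.2 h1) hq0
  have hle := (lintegral_mono_set hsub).trans hBL
  rw [hcone] at hle
  -- Only interior points satisfy the strict inequalities of the Brascamp-Lieb domain; the frontier
  -- of a convex set is null.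
  have hvol : volume C ≤ volume (interior C) := by
    have h1 : C ⊆ interior C ∪ frontier C := fun x hx => by
      by_cases h : x ∈ interior C
      · exact Or.inl h
      · exact Or.inr ⟨subset_closure hx, h⟩
    refine (measure_mono h1).trans ((measure_union_le _ _).trans ?_)
    rw [hC.addHaar_frontier volume, add_zero]
  refine hvol.trans ?_
  have hβ : regularSimplexVolume n = (p⁻¹ ^ n * n.factorial / q ^ (n + 1))⁻¹ := by
    rw [regularSimplexVolume, ← hp, ← hq, inv_pow]
    field_simp
  rw [hβ, ENNReal.ofReal_inv_of_pos (by positivity), ← one_div]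
  rw [mul_comm] at hle
  exact ENNReal.le_div_iff_mul_le (Or.inl (by simp; positivity)) (Or.inl ENNReal.ofReal_ne_top)
    |>.2 hle

/-! ### Lower bound for simplices containing the unit ball. -/

section Simplex

variable {F : Type*} [NormedAddCommGroup F] [InnerProductSpace ℝ F]

/-- **Hadamard's inequality** for a linear map given by its coordinate functionals in an
orthonormal basis. -/
theorem OrthonormalBasis.abs_det_sum_smulRight_le {m : ℕ} (e : OrthonormalBasis (Fin m) ℝ F)
    (w : Fin m → F) :
    |(∑ i, (innerSL ℝ (w i)).smulRight (e i) : F →L[ℝ] F).det| ≤ ∏ i, ‖w i‖ := by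
  have : Fact (Module.finrank ℝ F = m) :=
    ⟨by rw [Module.finrank_eq_card_basis e.toBasis, Fintype.card_fin]⟩
  have h := e.toBasis.orientation.abs_volumeForm_apply_le w
  rw [Orientation.volumeForm_robust' _ e] at h
  convert! h using 2
  have hL : ∀ i x, inner ℝ (e i) ((∑ i, (innerSL ℝ (w i)).smulRight (e i) : F →L[ℝ] F) x) =
      inner ℝ (w i) x := by
    intro i x
    simp [inner_sum, inner_smul_right, e.inner_eq_ite]
  rw [ContinuousLinearMap.det, ← LinearMap.det_toMatrix e.toBasis, Module.Basis.det_apply,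
    ← Matrix.det_transpose]
  congr 1
  ext i j
  rw [Matrix.transpose_apply, LinearMap.toMatrix_apply, Module.Basis.toMatrix_apply,
    e.coe_toBasis_repr_apply, e.coe_toBasis_repr_apply, e.coe_toBasis, e.repr_apply_apply,
    e.repr_apply_apply, real_inner_comm (w j)]
  exact hL j (e i)

/-- In orthonormal coordinates the integral is a product of copies of ∫₀^∞ exp(-t) dt = 1. -/
theorem OrthonormalBasis.lintegral_orthant_exp_neg_sum_inner [FiniteDimensional ℝ F] [MeasurableSpace F] [BorelSpace F]
    {ι : Type*} [Fintype ι] (e : OrthonormalBasis ι ℝ F) :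
    ∫⁻ x in {x : F | ∀ i, 0 < inner ℝ (e i) x},
      ENNReal.ofReal (Real.exp (-∑ i, inner ℝ (e i) x)) = 1 := by
  let f : ℝ → ℝ := (Set.Ioi (0 : ℝ)).indicator fun t => Real.exp (-t)
  have hf0 : ∀ t, 0 ≤ f t := fun t => Set.indicator_nonneg (fun _ _ => (Real.exp_pos _).le) t
  have hf1 : ∫ t, f t = 1 := by
    rw [integral_indicator measurableSet_Ioi, integral_exp_neg_Ioi_zero]
  have hfi : Integrable f := not_not.1 fun h => one_ne_zero (hf1.symm.trans (integral_undef h))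
  have hfm : Measurable f := Measurable.indicator (by fun_prop) measurableSet_Ioi
  have hprod : ∫⁻ y : ι → ℝ, ENNReal.ofReal (∏ i, f (y i)) = 1 := by
    rw [← ofReal_integral_eq_lintegral_ofReal, integral_fintype_prod_volume_eq_pow, hf1, one_pow,
      ENNReal.ofReal_one]
    · exact Integrable.fintype_prod fun _ => hfi
    · exact Filter.Eventually.of_forall fun y => Finset.prod_nonneg fun i _ => hf0 _
  have hmp := (PiLp.volume_preserving_ofLp ι).comp e.measurePreserving_repr
  have hm : MeasurableSet {x : F | ∀ i, 0 < inner ℝ (e i) x} := by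
    rw [Set.ofPred_forall]
    exact MeasurableSet.iInter fun i => (isOpen_lt (by fun_prop) (by fun_prop)).measurableSet
  rw [← hprod, ← hmp.lintegral_comp (by fun_prop), ← lintegral_indicator hm]
  refine lintegral_congr fun x => ?_
  have hfx : ∀ i, f ((WithLp.ofLp ∘ e.repr) x i) =
      (Set.Ioi (0 : ℝ)).indicator (fun t => Real.exp (-t)) (inner ℝ (e i) x) := by
    intro i
    rw [Function.comp_apply, e.repr_apply_apply]
  by_cases hx : ∀ i, 0 < inner ℝ (e i) x
  · rw [Set.indicator_of_mem (by exact hx), ← Finset.sum_neg_distrib, Real.exp_sum]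
    refine congrArg _ (Finset.prod_congr rfl fun i _ => ?_)
    rw [hfx, Set.indicator_of_mem (Set.mem_Ioi.2 (hx i))]
  · rw [Set.indicator_of_notMem (by exact hx)]
    push Not at hx
    obtain ⟨i, hi⟩ := hx
    rw [Finset.prod_eq_zero (Finset.mem_univ i), ENNReal.ofReal_zero]
    rw [hfx, Set.indicator_of_notMem (by simpa using hi)]

/-- The substitution x ↦ ∑ ⟪w_i, x⟫ e_i carries the domain onto an orthant, where the integral is 1;
Hadamard's inequality bounds the Jacobian by ∏ ‖w_i‖. This plays the part of a reverse Brascamp-Lieb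
inequality. -/
theorem one_le_prod_norm_mul_lintegral_exp_neg_sum_inner [FiniteDimensional ℝ F]
    [MeasurableSpace F] [BorelSpace F] {m : ℕ} (hm : Module.finrank ℝ F = m) (w : Fin m → F)
    (hw : ∀ x, (∀ i, inner ℝ (w i) x = 0) → x = 0) :
    1 ≤ ENNReal.ofReal (∏ i, ‖w i‖) * ∫⁻ x in {x : F | ∀ i, 0 < inner ℝ (w i) x},
      ENNReal.ofReal (Real.exp (-∑ i, inner ℝ (w i) x)) := by
  let e : OrthonormalBasis (Fin m) ℝ F := (stdOrthonormalBasis ℝ F).reindex (finCongr hm)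
  let L : F →L[ℝ] F := ∑ i, (innerSL ℝ (w i)).smulRight (e i)
  have heL : ∀ i x, inner ℝ (e i) (L x) = inner ℝ (w i) x := by
    intro i x
    simp [L, inner_sum, inner_smul_right, e.inner_eq_ite]
  have hinj : Function.Injective L := (injective_iff_map_eq_zero L).2 fun x hx =>
    hw x fun i => by rw [← heL, hx, inner_zero_right]
  have hsurj : Function.Surjective L := LinearMap.injective_iff_surjective.1 hinj
  set D := {x : F | ∀ i, 0 < inner ℝ (w i) x} with hD
  have hDm : MeasurableSet D := by
    rw [hD, Set.ofPred_forall]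
    exact MeasurableSet.iInter fun i => (isOpen_lt (by fun_prop) (by fun_prop)).measurableSet
  have hsub : {y | ∀ i, 0 < inner ℝ (e i) y} ⊆ L '' D := by
    intro y hy
    obtain ⟨x, rfl⟩ := hsurj y
    exact ⟨x, fun i => by rw [← heL]; exact hy i, rfl⟩
  calc (1 : ENNReal) = ∫⁻ x in {x : F | ∀ i, 0 < inner ℝ (e i) x},
        ENNReal.ofReal (Real.exp (-∑ i, inner ℝ (e i) x)) :=
        e.lintegral_orthant_exp_neg_sum_inner.symm
    _ ≤ ∫⁻ x in L '' D, ENNReal.ofReal (Real.exp (-∑ i, inner ℝ (e i) x)) :=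
        lintegral_mono_set hsub
    _ = ENNReal.ofReal |L.det| * ∫⁻ x in D, ENNReal.ofReal (Real.exp (-∑ i, inner ℝ (w i) x)) := by
        rw [lintegral_image_eq_lintegral_abs_det_fderiv_mul volume hDm
          (fun x _ => L.hasFDerivAt.hasFDerivWithinAt) hinj.injOn,
          lintegral_const_mul' _ _ ENNReal.ofReal_ne_top]
        simp only [heL]
    _ ≤ _ := by
        gcongr
        exact e.abs_det_sum_smulRight_le w

theorem prod_le_inv_card_pow {ι : Type*} [Fintype ι] [Nonempty ι] (h : ι → ℝ) (h0 : ∀ i, 0 ≤ h i)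
    (h1 : ∑ i, h i = 1) : ∏ i, h i ≤ ((Fintype.card ι : ℝ)⁻¹) ^ Fintype.card ι := by
  have hc : (0 : ℝ) < Fintype.card ι := by exact_mod_cast Fintype.card_pos
  have h2 := Real.geom_mean_le_arith_mean Finset.univ (fun _ => 1) h (fun _ _ => zero_le_one)
    (by simpa using hc) fun i _ => h0 i
  simp only [Real.rpow_one, Finset.sum_const, Finset.card_univ, nsmul_eq_mul, mul_one, one_mul,
    h1] at h2
  have h3 := pow_le_pow_left₀ (Real.rpow_nonneg (Finset.prod_nonneg fun i _ => h0 i) _) h2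
    (Fintype.card ι)
  rwa [← Real.rpow_natCast, ← Real.rpow_mul (Finset.prod_nonneg fun i _ => h0 i),
    inv_mul_cancel₀ hc.ne', Real.rpow_one, one_div] at h3

/-- A simplex that includes the unit ball is at least as large as the circumscribed regular
simplex. -/
theorem AffineBasis.regularSimplexVolume_le {n : ℕ} (hn : 1 ≤ n)
    (b : AffineBasis (Fin (n + 1)) ℝ (EuclideanSpace ℝ (Fin n)))
    (hB : Metric.closedBall 0 1 ⊆ convexHull ℝ (Set.range b)) :
    ENNReal.ofReal (regularSimplexVolume n) ≤ volume (convexHull ℝ (Set.range b)) := by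
  set p : ℝ := √n with hp
  set q : ℝ := √(n + 1) with hq
  have hn0 : (0 : ℝ) < n := by exact_mod_cast hn
  have hp0 : 0 < p := Real.sqrt_pos.2 hn0
  have hq0 : 0 < q := Real.sqrt_pos.2 (by positivity)
  have hp2 : p ^ 2 = n := Real.sq_sqrt hn0.le
  have hq2 : q ^ 2 = n + 1 := Real.sq_sqrt (by positivity)
  -- Gradients of the barycentric coordinates; `h` holds their values at the center of the ball.
  -- Testing at -a_i/‖a_i‖ shows that containing the ball forces ‖a_i‖ ≤ h_i.
  let a : Fin (n + 1) → EuclideanSpace ℝ (Fin n) := fun i =>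
    (InnerProductSpace.toDual ℝ _).symm (LinearMap.toContinuousLinearMap (b.coord i).linear)
  let h : Fin (n + 1) → ℝ := fun i => b.coord i 0
  have hcoord : ∀ i x, b.coord i x = inner ℝ (a i) x + h i := by
    intro i x
    rw [AffineMap.decomp (b.coord i)]
    simp [a, h]
  have hh1 : ∑ i, h i = 1 := b.sum_coord_apply_eq_one 0
  have ha0 : ∀ x, ∑ i, inner ℝ (a i) x = 0 := by
    intro x
    have h1 := b.sum_coord_apply_eq_one x
    simp only [hcoord, Finset.sum_add_distrib, hh1] at h1
    linarith
  have hhull : ∀ x, x ∈ convexHull ℝ (Set.range b) ↔ ∀ i, 0 ≤ inner ℝ (a i) x + h i := by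
    intro x
    rw [b.convexHull_eq_nonneg_coord]
    simp only [Set.mem_ofPred_eq, hcoord]
  have hah : ∀ i, ‖a i‖ ≤ h i := by
    intro i
    have hmem : -(‖a i‖⁻¹ • a i) ∈ Metric.closedBall (0 : EuclideanSpace ℝ (Fin n)) 1 := by
      rw [mem_closedBall_zero_iff, norm_neg, norm_smul, norm_inv, norm_norm]
      exact inv_mul_le_one
    have h1 := (hhull _).1 (hB hmem) i
    rw [inner_neg_right, inner_smul_right, real_inner_self_eq_norm_sq, pow_two] at h1
    rcases eq_or_ne ‖a i‖ 0 with h2 | h2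
    · rw [h2] at h1 ⊢
      simpa using h1
    · rw [inv_mul_cancel_left₀ h2] at h1
      linarith
  -- A height scale λ in place of p⁻¹ would bound the volume below by a constant times λ/(1 +
  -- λ²)^((n+1)/2), which is largest at λ = 1/√n.
  let w : Fin (n + 1) → WithLp 2 (EuclideanSpace ℝ (Fin n) × ℝ) := fun i =>
    WithLp.toLp 2 (a i, p⁻¹ * h i)
  have hwx : ∀ i x, inner ℝ (w i) x = inner ℝ (a i) x.fst + p⁻¹ * x.snd * h i := by
    intro i x
    simp only [w, WithLp.prod_inner_apply, RCLike.inner_apply, conj_trivial]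
    congr 1
    change x.snd * _ = _
    ring
  have hwsum : ∀ x, ∑ i, inner ℝ (w i) x = p⁻¹ * x.snd := by
    intro x
    simp only [hwx, Finset.sum_add_distrib, ha0, ← Finset.mul_sum, hh1]
    ring
  have hwnorm : ∀ i, ‖w i‖ ≤ q / p * h i := by
    intro i
    have hhi : 0 ≤ h i := (norm_nonneg _).trans (hah i)
    rw [← sq_le_sq₀ (norm_nonneg _) (by positivity), WithLp.prod_norm_sq_eq_of_L2]
    change ‖a i‖ ^ 2 + ‖p⁻¹ * h i‖ ^ 2 ≤ _
    have h1 : ‖a i‖ ^ 2 ≤ h i ^ 2 := pow_le_pow_left₀ (norm_nonneg _) (hah i) 2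
    rw [Real.norm_eq_abs, sq_abs, mul_pow, mul_pow, div_pow, inv_pow, hp2, hq2]
    calc ‖a i‖ ^ 2 + (n : ℝ)⁻¹ * h i ^ 2 ≤ h i ^ 2 + (n : ℝ)⁻¹ * h i ^ 2 := by gcongr
      _ = (n + 1) / n * h i ^ 2 := by field_simp
  have hfin : Module.finrank ℝ (WithLp 2 (EuclideanSpace ℝ (Fin n) × ℝ)) = n + 1 := by
    rw [(WithLp.linearEquiv 2 ℝ (EuclideanSpace ℝ (Fin n) × ℝ)).finrank_eq]
    simp
  have hw0 : ∀ x, (∀ i, inner ℝ (w i) x = 0) → x = 0 := by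
    intro x h1
    have h2 : x.snd = 0 := by
      have h3 := hwsum x
      simp only [h1, Finset.sum_const_zero] at h3
      exact (mul_eq_zero.1 h3.symm).resolve_left (by positivity)
    have h4 : x.fst = 0 := by
      refine b.ext_elem fun i => ?_
      have h5 := h1 i
      rw [hwx, h2] at h5
      rw [hcoord, hcoord, inner_zero_right]
      linarith
    exact (WithLp.ofLp_injective 2) (Prod.ext h4 h2)
  set T := convexHull ℝ (Set.range b) with hT
  have hTm : MeasurableSet T :=
    ((Set.finite_range b).isCompact_convexHull ℝ).isClosed.measurableSet
  have hsub : {x | ∀ i, 0 < inner ℝ (w i) x} ⊆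
      {x | 0 < x.snd ∧ (p⁻¹ * x.snd)⁻¹ • x.fst ∈ T} := by
    intro x hx
    have hr : 0 < x.snd := by
      have h1 : 0 < ∑ i, inner ℝ (w i) x :=
        Finset.sum_pos (fun i _ => hx i) Finset.univ_nonempty
      rw [hwsum] at h1
      exact (mul_pos_iff_of_pos_left (inv_pos.2 hp0)).1 h1
    refine ⟨hr, (hhull _).2 fun i => ?_⟩
    have h1 := hx i
    rw [hwx] at h1
    have h2 : 0 < p⁻¹ * x.snd := by positivity
    rw [inner_smul_right, ← mul_le_mul_iff_right₀ h2, mul_zero, mul_add, mul_inv_cancel_left₀ h2.ne']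
    exact h1.le
  have hint := one_le_prod_norm_mul_lintegral_exp_neg_sum_inner hfin w hw0
  simp only [hwsum] at hint
  replace hint := hint.trans (mul_le_mul_right (lintegral_mono_set hsub) _)
  rw [lintegral_cone_exp_neg hTm (inv_pos.2 hp0) (inv_pos.2 hp0), finrank_euclideanSpace_fin] at hint
  have hdet : ∏ i, ‖w i‖ ≤ (q / p) ^ (n + 1) * ((n + 1 : ℝ)⁻¹) ^ (n + 1) := by
    have hh0 : ∀ i, 0 ≤ h i := fun i => (norm_nonneg _).trans (hah i)
    have h2 := prod_le_inv_card_pow h hh0 hh1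
    rw [Fintype.card_fin] at h2
    push_cast at h2
    calc ∏ i, ‖w i‖ ≤ ∏ i, (q / p * h i) := Finset.prod_le_prod (fun _ _ => norm_nonneg _) fun i _ => hwnorm i
      _ = (q / p) ^ (n + 1) * ∏ i, h i := by
        rw [Finset.prod_mul_distrib, Finset.prod_const, Finset.card_univ, Fintype.card_fin]
      _ ≤ _ := by gcongr
  have hβ : (regularSimplexVolume n)⁻¹ = (q / p) ^ (n + 1) * ((n + 1 : ℝ)⁻¹) ^ (n + 1) *
      (p⁻¹ ^ n * n.factorial / p⁻¹ ^ (n + 1)) := by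
    rw [regularSimplexVolume, ← hp, ← hq, ← hq2]
    simp only [div_pow, inv_pow]
    field_simp
    ring
  have hβ0 : 0 < regularSimplexVolume n := by
    rw [regularSimplexVolume, ← hp, ← hq]
    positivity
  have hfinal : (1 : ENNReal) ≤ (ENNReal.ofReal (regularSimplexVolume n))⁻¹ * volume T := by
    refine hint.trans ?_
    rw [← mul_assoc, ← ENNReal.ofReal_mul (Finset.prod_nonneg fun _ _ => norm_nonneg _), ← ENNReal.ofReal_inv_of_pos hβ0, hβ]
    gcongr
  rw [mul_comm, ← div_eq_mul_inv] at hfinal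
  simpa using (ENNReal.le_div_iff_mul_le (Or.inl (by simpa using hβ0))
    (Or.inl ENNReal.ofReal_ne_top)).1 hfinal

end Simplex

/-! ### Affine invariance and the comparison of volume ratios. -/

section VolumeRatio

variable {n : ℕ}

theorem AffineEquiv.volume_image
    (f : EuclideanSpace ℝ (Fin n) ≃ᵃ[ℝ] EuclideanSpace ℝ (Fin n))
    (s : Set (EuclideanSpace ℝ (Fin n))) :
    volume (f '' s) = ENNReal.ofReal |LinearMap.det (f.linear :
      EuclideanSpace ℝ (Fin n) →ₗ[ℝ] EuclideanSpace ℝ (Fin n))| * volume s := by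
  have h : f '' s = (fun x => x + f 0) '' ((f.linear :
      EuclideanSpace ℝ (Fin n) →ₗ[ℝ] EuclideanSpace ℝ (Fin n)) '' s) := by
    rw [Set.image_image]
    refine Set.image_congr fun x _ => ?_
    simpa using f.map_vadd 0 x
  rw [h, Set.image_add_right, measure_preimage_add_right, Measure.addHaar_image_linearMap]

theorem AffineEquiv.abs_det_linear_pos
    (f : EuclideanSpace ℝ (Fin n) ≃ᵃ[ℝ] EuclideanSpace ℝ (Fin n)) :
    0 < |LinearMap.det (f.linear :
      EuclideanSpace ℝ (Fin n) →ₗ[ℝ] EuclideanSpace ℝ (Fin n))| :=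
  abs_pos.2 f.linear.isUnit_det'.ne_zero

theorem IsEllipsoid.image {E : Set (EuclideanSpace ℝ (Fin n))} (hE : IsEllipsoid E)
    (f : EuclideanSpace ℝ (Fin n) ≃ᵃ[ℝ] EuclideanSpace ℝ (Fin n)) : IsEllipsoid (f '' E) := by
  obtain ⟨g, rfl⟩ := hE
  exact ⟨g.trans f, by rw [Set.image_image]; rfl⟩

/-- Affine changes of coordinates preserve maximality of ellipsoids. -/
theorem IsMaximalEllipsoid.preimage {C E : Set (EuclideanSpace ℝ (Fin n))}
    {f : EuclideanSpace ℝ (Fin n) ≃ᵃ[ℝ] EuclideanSpace ℝ (Fin n)}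
    (h : IsMaximalEllipsoid C (f '' E)) (hE : IsEllipsoid E) :
    IsMaximalEllipsoid (f ⁻¹' C) E where
  isEllipsoid := hE
  subset := Set.image_subset_iff.1 h.subset
  volume_le E' hE' hE'C := by
    have h1 := h.volume_le _ (hE'.image f) (Set.image_subset_iff.2 hE'C)
    rw [f.volume_image, f.volume_image] at h1
    exact (ENNReal.mul_le_mul_iff_right (by simpa using f.abs_det_linear_pos.ne')
      ENNReal.ofReal_ne_top).1 h1

theorem isEllipsoid_closedBall : IsEllipsoid (Metric.closedBall (0 : EuclideanSpace ℝ (Fin n)) 1) :=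
  ⟨AffineEquiv.refl ℝ _, by simp⟩

theorem AffineEquiv.volume_real_image_div
    (f : EuclideanSpace ℝ (Fin n) ≃ᵃ[ℝ] EuclideanSpace ℝ (Fin n))
    (s t : Set (EuclideanSpace ℝ (Fin n))) :
    volume.real (f '' s) / volume.real (f '' t) = volume.real s / volume.real t := by
  simp only [Measure.real, f.volume_image, ENNReal.toReal_mul,
    ENNReal.toReal_ofReal (abs_nonneg _)]
  exact mul_div_mul_left _ _ f.abs_det_linear_pos.ne'

theorem regularSimplexVolume_nonneg : 0 ≤ regularSimplexVolume n := by
  rw [regularSimplexVolume]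
  positivity

theorem IsMaximalEllipsoid.volume_real_div_le (hn : 1 ≤ n)
    {C E : Set (EuclideanSpace ℝ (Fin n))} (hC : Convex ℝ C) (h : IsMaximalEllipsoid C E) :
    volume.real C / volume.real E ≤ regularSimplexVolume n /
      volume.real (Metric.closedBall (0 : EuclideanSpace ℝ (Fin n)) 1) := by
  obtain ⟨f, rfl⟩ := h.isEllipsoid
  have h1 := (h.preimage isEllipsoid_closedBall).volume_le_regularSimplexVolume hn
    (hC.affine_preimage f.toAffineMap)
  conv_lhs => rw [← Set.image_preimage_eq C f.surjective]
  rw [f.volume_real_image_div]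
  gcongr
  exact ENNReal.toReal_le_of_le_ofReal regularSimplexVolume_nonneg h1

/-- Pull `E` back to the unit ball; simplices go to simplices. Inclusion is enough here, so the
maximal ellipsoid of a simplex need not be identified. -/
theorem IsEllipsoid.le_volume_real_simplex_div (hn : 1 ≤ n)
    (T : Affine.Simplex ℝ (EuclideanSpace ℝ (Fin n)) n) {E : Set (EuclideanSpace ℝ (Fin n))}
    (hE : IsEllipsoid E) (hET : E ⊆ convexHull ℝ (Set.range T.points)) :
    regularSimplexVolume n / volume.real (Metric.closedBall (0 : EuclideanSpace ℝ (Fin n)) 1) ≤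
      volume.real (convexHull ℝ (Set.range T.points)) / volume.real E := by
  obtain ⟨f, rfl⟩ := hE
  have hi : AffineIndependent ℝ (f.symm ∘ T.points) := f.symm.affineIndependent_iff.2 T.independent
  let b : AffineBasis (Fin (n + 1)) ℝ (EuclideanSpace ℝ (Fin n)) :=
    ⟨f.symm ∘ T.points, hi, hi.affineSpan_eq_top_iff_card_eq_finrank_add_one.2 (by simp)⟩
  have hb : f '' convexHull ℝ (Set.range b) = convexHull ℝ (Set.range T.points) := by
    refine (AffineMap.image_convexHull f.toAffineMap _).trans ?_
    rw [← Set.range_comp]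
    congr 2
    ext1 i
    exact f.apply_symm_apply _
  rw [← hb] at hET ⊢
  rw [f.volume_real_image_div]
  gcongr
  exact (ENNReal.ofReal_le_iff_le_toReal
    ((Set.finite_range b).isCompact_convexHull ℝ).measure_lt_top.ne).1
    (b.regularSimplexVolume_le hn ((Set.image_subset_image_iff f.injective).1 hET))

end VolumeRatio

theorem mainTheorem2 (n : ℕ) (hn : 1 ≤ n) :
    (∀ (C : ConvexBody (EuclideanSpace ℝ (Fin n)))
        (hC : (interior (C : Set (EuclideanSpace ℝ (Fin n)))).Nonempty)
        (T : Affine.Simplex ℝ (EuclideanSpace ℝ (Fin n)) n),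
        C.volumeRatio hC ≤ (solidSimplex T).volumeRatio (solidSimplex_interior_nonempty T)) ∧
    (∀ C : ConvexBody (EuclideanSpace ℝ (Fin n)),
        IsMaximalEllipsoid (C : Set (EuclideanSpace ℝ (Fin n))) (Metric.closedBall 0 1) →
        volume.real (C : Set (EuclideanSpace ℝ (Fin n))) ≤
          (n : ℝ) ^ ((n : ℝ) / 2) * ((n : ℝ) + 1) ^ (((n : ℝ) + 1) / 2) / (n.factorial : ℝ)) := by
  refine ⟨fun C hC T => ?_, fun C hC => ?_⟩
  · have h1 : IsMaximalEllipsoid C (C.maximalEllipsoid hC) :=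
      Classical.choose_spec (C.exists_isMaximalEllipsoid hC)
    have h2 : IsMaximalEllipsoid (solidSimplex T)
        ((solidSimplex T).maximalEllipsoid (solidSimplex_interior_nonempty T)) :=
      Classical.choose_spec ((solidSimplex T).exists_isMaximalEllipsoid (solidSimplex_interior_nonempty T))
    exact Real.rpow_le_rpow (by positivity)
      ((h1.volume_real_div_le hn C.convex).trans
        (h2.isEllipsoid.le_volume_real_simplex_div hn T h2.subset)) (by positivity)
  · rw [← regularSimplexVolume_eq]
    exact ENNReal.toReal_le_of_le_ofReal regularSimplexVolume_nonneg
      (hC.volume_le_regularSimplexVolume hn C.convex)
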